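/- Let $n,k,\ell$ be integers with $1\le k\le n$ and $\ell\ge 2$, put $\Delta=(\ell-1)k\ge 1$, and let $\mathbb F$ be a finite field with $q$ elements. For a matrix $M$ with $n$ columns and a set $A\subseteq[n]=\{1,\dots,n\}$, let $M_A$ denote the span of the columns of $M$ indexed by $A$. Let $W$ be the generic $k\times n$ matrix over $\mathbb F$, that is, the matrix whose entries are $kn$ independent indeterminates over $\mathbb F$, regarded as a matrix over the field of rational functions in these indeterminates. A linear code $\mathcal C\subseteq\mathbb F^n$ is called an $(n,k)$-MDS$(\ell)$ code if it has dimension $k$ and has a generator matrix $G\in\mathbb F^{k\times n}$ such that for all $A_1,\dots,A_\ell\subseteq[n]$ with $|A_i|\le k$ for every $i$, $$\dim\left(G_{A_1}\cap\cdots\cap G_{A_\ell}\right)=\dim\left(W_{A_1}\cap\cdots\cap W_{A_\ell}\right).$$ **Theorem.** If $$q\;\ge\; e\,\ell\,k^2\cdot\min\left(2^n,\;\Delta\left(\frac{en}{\Delta/\ell}\right)^{\Delta}\right)\cdot\min\left(2^{\ell\min(\Delta,n)},\;k^{\ell}\min(\Delta,n)^{k\ell}\right),$$ where $e$ is the base of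 the natural logarithm, then there exists an $(n,k)$-MDS$(\ell)$ code over $\mathbb F$. -/

import Mathlib

/-- The span of the columns of the matrix `M` indexed by the set `A`. -/
def colSpan {k n : ℕ} {K : Type*} [Field K] (M : Matrix (Fin k) (Fin n) K)
    (A : Finset (Fin n)) : Submodule K (Fin k → K) :=
  Submodule.span K ((fun j : Fin n => fun i : Fin k => M i j) '' (A : Set (Fin n)))

/-- The generic `k × n` matrix in the characteristic of `F`: its entries are `k * n` independent
indeterminates, regarded as elements of the rational function field over `F`. -/
noncomputable def genericMatrix (k n : ℕ) (F : Type*) [Field F] :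
    Matrix (Fin k) (Fin n) (FractionRing (MvPolynomial (Fin k × Fin n) F)) :=
  fun i j => algebraMap (MvPolynomial (Fin k × Fin n) F) _ (MvPolynomial.X (i, j))

/-- `G` is a generator matrix of the linear code `C`: its rows are linearly independent and
span `C`. -/
def IsGeneratorMatrix {k n : ℕ} {F : Type*} [Field F] (G : Matrix (Fin k) (Fin n) F)
    (C : Submodule F (Fin n → F)) : Prop :=
  LinearIndependent F (fun i : Fin k => G i) ∧
    Submodule.span F (Set.range fun i : Fin k => G i) = C

/-- The linear code `C` of length `n` over `F` is an `(n,k)`-MDS(`ℓ`) code: it has dimension `k` and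
a generator matrix `G` such that for any `ℓ` sets of at most `k` columns, the intersection of the
spans of these columns of `G` has the same dimension as for the generic matrix. -/
def IsHigherOrderMDS {n : ℕ} {F : Type*} [Field F] (k ℓ : ℕ)
    (C : Submodule F (Fin n → F)) : Prop :=
  Module.finrank F C = k ∧
    ∃ G : Matrix (Fin k) (Fin n) F, IsGeneratorMatrix G C ∧
      ∀ A : Fin ℓ → Finset (Fin n), (∀ i, (A i).card ≤ k) →
        Module.finrank F (⨅ i, colSpan G (A i) : Submodule F (Fin k → F)) =
          Module.finrank (FractionRing (MvPolynomial (Fin k × Fin n) F))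
            (⨅ i, colSpan (genericMatrix k n F) (A i) :
              Submodule (FractionRing (MvPolynomial (Fin k × Fin n) F))
                (Fin k → FractionRing (MvPolynomial (Fin k × Fin n) F)))

/-! Write `ℓ = m + 1`. By rank-nullity, the intersection of `ℓ` column spans has dimension equal to
the sum of their dimensions minus the rank of a block matrix with `m * k = Δ` rows
(`finrank_iInf_colSpan_add`). It therefore suffices to find `G` whose block matrix has the generic
rank on every admissible set of columns. Specialization never raises rank. Conversely, a maximal
independent set of generic columns has at most `Δ` elements, so only families of total size at most
`Δ` have to be kept independent. Each costs one nonzero minor of degree at most `Δ`; over a field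
with more than `Δ` times as many elements as there are such families, these minors have a common
non-root (`exists_forall_eval_ne_zero`). The stated bound on `q` comes from counting these families
(`card_smallFamilies_le`). -/

/-! ### Minors, specialization and common non-roots -/

/-- A matrix over a field with linearly independent columns has a nonzero maximal minor. -/
theorem exists_submatrix_det_ne_zero {ι κ K : Type*} [Fintype ι] [Fintype κ] [DecidableEq κ]
    [Field K] (A : Matrix ι κ K) (hA : LinearIndependent K A.col) :
    ∃ f : κ → ι, (A.submatrix f id).det ≠ 0 := by
  obtain ⟨κ', a, -, hspan, hli⟩ := exists_linearIndependent' K A.row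
  have hrank : A.rank = Fintype.card κ := by
    rw [Matrix.rank_eq_finrank_span_cols, finrank_span_eq_card hA]
  have htop : Submodule.span K (Set.range A.row) = ⊤ := by
    apply Submodule.eq_top_of_finrank_eq
    rw [← Matrix.rank_eq_finrank_span_row, hrank, Module.finrank_fintype_fun_eq_card]
  let b : Module.Basis κ' K (κ → K) := Module.Basis.mk hli (by rw [hspan, htop])
  let e : κ ≃ κ' := (Pi.basisFun K κ).indexEquiv b
  refine ⟨a ∘ e, ?_⟩
  have h : LinearIndependent K (A.submatrix (a ∘ e) id).row := hli.comp e e.injective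
  exact ((Matrix.isUnit_iff_isUnit_det _).1 (Matrix.linearIndependent_rows_iff_isUnit.1 h)).ne_zero

theorem linearIndependent_col_of_submatrix_det_ne_zero {ι κ K : Type*} [Fintype κ] [DecidableEq κ]
    [Field K] (A : Matrix ι κ K) (f : κ → ι) (hf : (A.submatrix f id).det ≠ 0) :
    LinearIndependent K A.col := by
  have h : LinearIndependent K (A.submatrix f id).col :=
    Matrix.linearIndependent_cols_of_det_ne_zero hf
  exact LinearIndependent.of_comp (LinearMap.funLeft K K f) h

/-- Linear independence of columns at a specialization implies it for the generic matrix. -/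
theorem linearIndependent_col_map_algebraMap {σ ι κ F : Type*} [Fintype ι] [Finite κ] [Field F]
    (N : Matrix ι κ (MvPolynomial σ F)) (g : σ → F)
    (h : LinearIndependent F (N.map (MvPolynomial.eval g)).col) :
    LinearIndependent (FractionRing (MvPolynomial σ F))
      (N.map (algebraMap (MvPolynomial σ F) (FractionRing (MvPolynomial σ F)))).col := by
  classical
  have := Fintype.ofFinite κ
  obtain ⟨f, hf⟩ := exists_submatrix_det_ne_zero _ h
  apply linearIndependent_col_of_submatrix_det_ne_zero _ f
  rw [Matrix.submatrix_map, ← RingHom.mapMatrix_apply, ← RingHom.map_det] at hf ⊢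
  intro h0
  rw [(map_eq_zero_iff _ (IsFractionRing.injective _ _)).1 h0, map_zero] at hf
  exact hf rfl

theorem totalDegree_det_le {σ κ R : Type*} [Fintype κ] [DecidableEq κ] [CommRing R]
    (N : Matrix κ κ (MvPolynomial σ R)) (hN : ∀ i j, (N i j).totalDegree ≤ 1) :
    N.det.totalDegree ≤ Fintype.card κ := by
  rw [Matrix.det_apply']
  refine MvPolynomial.totalDegree_finsetSum_le fun p _ => ?_
  refine (MvPolynomial.totalDegree_mul _ _).trans ?_
  have h1 : (((Equiv.Perm.sign p : ℤˣ) : ℤ) : MvPolynomial σ R).totalDegree = 0 := by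
    rw [← map_intCast (MvPolynomial.C : R →+* MvPolynomial σ R), MvPolynomial.totalDegree_C]
  rw [h1, zero_add]
  refine (MvPolynomial.totalDegree_finsetProd _ _).trans ?_
  exact (Finset.sum_le_sum fun i _ => hN _ _).trans (by simp)

/-- If the generic matrix has independent columns, this is witnessed by a polynomial of degree at
most the number of columns. -/
theorem exists_polynomial_linearIndependent_col {σ ι κ F : Type*} [Fintype ι] [Fintype κ] [Field F]
    (N : Matrix ι κ (MvPolynomial σ F)) (hN : ∀ i j, (N i j).totalDegree ≤ 1) :
    ∃ p : MvPolynomial σ F, p ≠ 0 ∧ p.totalDegree ≤ Fintype.card κ ∧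
      (LinearIndependent (FractionRing (MvPolynomial σ F))
        (N.map (algebraMap (MvPolynomial σ F) (FractionRing (MvPolynomial σ F)))).col →
      ∀ g : σ → F, MvPolynomial.eval g p ≠ 0 →
        LinearIndependent F (N.map (MvPolynomial.eval g)).col) := by
  classical
  by_cases h : LinearIndependent (FractionRing (MvPolynomial σ F))
      (N.map (algebraMap (MvPolynomial σ F) (FractionRing (MvPolynomial σ F)))).col
  · obtain ⟨f, hf⟩ := exists_submatrix_det_ne_zero _ h
    refine ⟨(N.submatrix f id).det, ?_, totalDegree_det_le _ fun i j => hN _ _, fun _ g hg => ?_⟩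
    · rintro h0
      rw [Matrix.submatrix_map, ← RingHom.mapMatrix_apply, ← RingHom.map_det, h0, map_zero] at hf
      exact hf rfl
    · apply linearIndependent_col_of_submatrix_det_ne_zero _ f
      rwa [Matrix.submatrix_map, ← RingHom.mapMatrix_apply, ← RingHom.map_det]
  -- Nothing has to be preserved here; the constant `1` gives every family a polynomial.
  · exact ⟨1, one_ne_zero, by simp, fun h' => absurd h' h⟩

/-- Finitely many nonzero polynomials of bounded degree over a large finite field have a common
non-root. -/
theorem exists_forall_eval_ne_zero {σ τ F : Type*} [Finite σ] [Field F] [Fintype F]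
    (T : Finset τ) (p : τ → MvPolynomial σ F) (d : ℕ) (hp : ∀ t ∈ T, p t ≠ 0)
    (hd : ∀ t ∈ T, (p t).totalDegree ≤ d) (hq : T.card * d < Fintype.card F) :
    ∃ g : σ → F, ∀ t ∈ T, MvPolynomial.eval g (p t) ≠ 0 := by
  by_contra! hcon
  -- The product has degree below `Fintype.card F` in each variable, so vanishing at every point of
  -- `σ → F` makes it zero.
  have h0 : ∏ t ∈ T, p t = 0 := by
    refine MvPolynomial.eq_zero_of_eval_zero_at_prod_finset _ (fun _ => Finset.univ) (fun i => ?_)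
      fun g _ => ?_
    · refine lt_of_le_of_lt ((MvPolynomial.degreeOf_le_totalDegree _ _).trans ?_) hq
      refine (MvPolynomial.totalDegree_finsetProd _ _).trans ?_
      exact (Finset.sum_le_sum hd).trans (by simp)
    · obtain ⟨t, ht, h⟩ := hcon g
      rw [map_prod]
      exact Finset.prod_eq_zero ht h
  obtain ⟨t, ht, h⟩ := Finset.prod_eq_zero_iff.1 h0
  exact hp t ht h

/-- If independence of subfamilies transfers from `v` to `w`, then so does the lower bound on the
dimension of the span. -/
theorem finrank_span_image_le {ι K K' V V' : Type*} [Field K] [Field K'] [AddCommGroup V]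
    [AddCommGroup V'] [Module K V] [Module K' V'] [FiniteDimensional K V] [FiniteDimensional K' V']
    (v : ι → V) (w : ι → V') (E : Set ι)
    (h : ∀ b ⊆ E, LinearIndepOn K v b → LinearIndepOn K' w b) :
    Module.finrank K (Submodule.span K (v '' E)) ≤
      Module.finrank K' (Submodule.span K' (w '' E)) := by
  obtain ⟨b, hbE, -, hspan, hli⟩ :=
    exists_linearIndepOn_extension (linearIndepOn_empty K v) (Set.empty_subset E)
  have hw := h b hbE hli
  have : Finite b := hli.finite
  have := Fintype.ofFinite b
  have h1 : Submodule.span K (v '' E) = Submodule.span K (Set.range fun x : b => v x) := by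
    rw [← Set.image_eq_range]
    exact le_antisymm (Submodule.span_le.2 hspan) (Submodule.span_mono (Set.image_mono hbE))
  rw [h1, finrank_span_eq_card hli, ← finrank_span_eq_card hw]
  apply Submodule.finrank_mono
  rw [← Set.image_eq_range]
  exact Submodule.span_mono (Set.image_mono hbE)

/-! ### Intersections of column spans as kernels -/

/-- The linear map sending `v` to the vector whose block `t` is `v` if `i = 0` or `i = t + 1`. -/
def blockEmbedding (m k : ℕ) (K : Type*) [Field K] (i : Fin (m + 1)) :
    (Fin k → K) →ₗ[K] (Fin m × Fin k → K) where
  toFun v a := if i = 0 ∨ i = a.1.succ then v a.2 else 0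
  map_add' v w := by ext a; by_cases h : i = 0 ∨ i = a.1.succ <;> simp [h]
  map_smul' c v := by ext a; by_cases h : i = 0 ∨ i = a.1.succ <;> simp [h]

/-- The block matrix whose kernel encodes the intersection of `m + 1` column spans of `M`. -/
def intersectionMatrix {k n : ℕ} {R : Type*} [Zero R] (m : ℕ) (M : Matrix (Fin k) (Fin n) R) :
    Matrix (Fin m × Fin k) (Fin (m + 1) × Fin n) R :=
  fun a b => if b.1 = 0 ∨ b.1 = a.1.succ then M a.2 b.2 else 0

theorem intersectionMatrix_map {k n : ℕ} {R S : Type*} [Semiring R] [Semiring S] (m : ℕ)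
    (M : Matrix (Fin k) (Fin n) R) (f : R →+* S) :
    intersectionMatrix m (M.map f) = (intersectionMatrix m M).map f := by
  ext a b
  by_cases h : b.1 = 0 ∨ b.1 = a.1.succ <;> simp [intersectionMatrix, h]

theorem sum_blockEmbedding_apply {m k : ℕ} {K : Type*} [Field K] (u : Fin (m + 1) → Fin k → K)
    (a : Fin m × Fin k) :
    (∑ i, blockEmbedding m k K i (u i)) a = u 0 a.2 + u a.1.succ a.2 := by
  rw [Finset.sum_apply, Fin.sum_univ_succ]
  simp [blockEmbedding, Fin.succ_ne_zero, Fin.succ_inj]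

/-- Rank-nullity for the sum map on the product of the `U i`. Block `t` of the image of `u` is `u 0
+ u t.succ`, so the kernel consists of the tuples `(v, -v, ..., -v)` with `v` in every `U i`. -/
theorem finrank_iInf_add_finrank_iSup_map {m k : ℕ} {K : Type*} [Field K]
    (U : Fin (m + 1) → Submodule K (Fin k → K)) :
    Module.finrank K (⨅ i, U i : Submodule K (Fin k → K)) +
        Module.finrank K (⨆ i, (U i).map (blockEmbedding m k K i) :
          Submodule K (Fin m × Fin k → K)) =
      ∑ i, Module.finrank K (U i) := by
  classical
  let Φ : ((i : Fin (m + 1)) → U i) →ₗ[K] (Fin m × Fin k → K) :=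
    ∑ i, (blockEmbedding m k K i) ∘ₗ (U i).subtype ∘ₗ LinearMap.proj i
  have hΦ (u) : Φ u = ∑ i, blockEmbedding m k K i (u i) := by simp [Φ]
  let ψ : (⨅ i, U i : Submodule K (Fin k → K)) →ₗ[K] ((i : Fin (m + 1)) → U i) :=
    LinearMap.pi fun i => (if i = 0 then (1 : K) else -1) • Submodule.inclusion (iInf_le U i)
  have hψ (v i) : (ψ v i : Fin k → K) = (if i = 0 then (1 : K) else -1) • (v : Fin k → K) := rfl
  have hinj : Function.Injective ψ := by
    intro v w h
    have := congrArg (fun u => (u 0 : Fin k → K)) h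
    simp only [hψ] at this
    simpa using this
  have hrange : LinearMap.range Φ = ⨆ i, (U i).map (blockEmbedding m k K i) := by
    apply le_antisymm
    · rintro _ ⟨u, rfl⟩
      rw [hΦ]
      exact Submodule.sum_mem _ fun i _ => Submodule.mem_iSup_of_mem i
        (Submodule.mem_map_of_mem (u i).2)
    · refine iSup_le fun i => ?_
      rintro _ ⟨x, hx, rfl⟩
      refine ⟨Pi.single i ⟨x, hx⟩, ?_⟩
      rw [hΦ, Finset.sum_eq_single i]
      · simp
      · intro j _ hj
        simp [Pi.single_eq_of_ne hj]
      · simp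
  have hker : LinearMap.range ψ = LinearMap.ker Φ := by
    apply le_antisymm
    · rintro _ ⟨v, rfl⟩
      rw [LinearMap.mem_ker, hΦ]
      ext a
      rw [sum_blockEmbedding_apply (fun i => (ψ v i : Fin k → K))]
      simp [hψ, Fin.succ_ne_zero]
    · intro u hu
      rw [LinearMap.mem_ker, hΦ] at hu
      have h (t : Fin m) : (u t.succ : Fin k → K) = -(u 0 : Fin k → K) := by
        ext r
        have := congrFun hu (t, r)
        rw [sum_blockEmbedding_apply (fun i => (u i : Fin k → K))] at this
        exact eq_neg_of_add_eq_zero_right this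
      have hmem : (u 0 : Fin k → K) ∈ ⨅ i, U i := by
        rw [Submodule.mem_iInf]
        refine Fin.cases (u 0).2 fun t => ?_
        rw [← neg_mem_iff, ← h]
        exact (u t.succ).2
      refine ⟨⟨_, hmem⟩, ?_⟩
      funext i
      apply Subtype.ext
      rw [hψ]
      refine Fin.cases ?_ (fun t => ?_) i
      · simp
      · simp [Fin.succ_ne_zero, h]
  rw [← hrange, ← LinearMap.finrank_range_of_inj hinj, hker, add_comm,
    LinearMap.finrank_range_add_finrank_ker, Module.finrank_pi_fintype]

/-- The pairs `(i, j)` with `j ∈ A i`. -/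
def graphSet {ι α : Type*} (A : ι → Finset α) : Set (ι × α) :=
  {b | b.2 ∈ A b.1}

theorem iSup_map_colSpan {m k n : ℕ} {K : Type*} [Field K] (M : Matrix (Fin k) (Fin n) K)
    (A : Fin (m + 1) → Finset (Fin n)) :
    ⨆ i, (colSpan M (A i)).map (blockEmbedding m k K i) =
      Submodule.span K ((intersectionMatrix m M).col '' graphSet A) := by
  simp_rw [colSpan, Submodule.map_span, ← Submodule.span_iUnion]
  congr 1
  ext x
  simp only [Set.mem_iUnion, Set.mem_image, Finset.mem_coe, graphSet, Set.mem_ofPred_eq,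
    Prod.exists]
  constructor
  · rintro ⟨i, _, ⟨j, hj, rfl⟩, rfl⟩
    exact ⟨i, j, hj, rfl⟩
  · rintro ⟨i, j, hj, rfl⟩
    exact ⟨i, _, ⟨j, hj, rfl⟩, rfl⟩

theorem finrank_iInf_colSpan_add {m k n : ℕ} {K : Type*} [Field K] (M : Matrix (Fin k) (Fin n) K)
    (A : Fin (m + 1) → Finset (Fin n)) :
    Module.finrank K (⨅ i, colSpan M (A i) : Submodule K (Fin k → K)) +
        Module.finrank K (Submodule.span K ((intersectionMatrix m M).col '' graphSet A)) =
      ∑ i, Module.finrank K (colSpan M (A i)) := by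
  rw [← iSup_map_colSpan, finrank_iInf_add_finrank_iSup_map]

theorem colSpan_empty {k n : ℕ} {K : Type*} [Field K] (M : Matrix (Fin k) (Fin n) K) :
    colSpan M ∅ = ⊥ := by
  simp [colSpan]

/-- Since `1 ≤ m`, at least one other set is empty, so the intersection vanishes and only one
summand survives. Thus block ranks also control the dimensions of single spans. -/
theorem finrank_colSpan_eq {m k n : ℕ} {K : Type*} [Field K] (hm : 1 ≤ m)
    (M : Matrix (Fin k) (Fin n) K) (A : Finset (Fin n)) :
    Module.finrank K (colSpan M A) = Module.finrank K (Submodule.span K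
      ((intersectionMatrix m M).col '' graphSet fun i => if i = 0 then A else ∅)) := by
  have h := finrank_iInf_colSpan_add (m := m) M fun i => if i = 0 then A else ∅
  have hbot : ⨅ i : Fin (m + 1), colSpan M (if i = 0 then A else ∅) = ⊥ := by
    refine eq_bot_iff.2 ((iInf_le _ (Fin.last m)).trans ?_)
    rw [if_neg (by rw [Fin.ext_iff]; simp; omega), colSpan_empty]
  rw [hbot, finrank_bot, zero_add, Fin.sum_univ_succ] at h
  have h0 (i : Fin m) : Module.finrank K (colSpan M (if i.succ = 0 then A else ∅)) = 0 := by
    rw [if_neg (Fin.succ_ne_zero i), colSpan_empty, finrank_bot]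
  rw [Finset.sum_eq_zero fun i _ => h0 i, if_pos rfl, add_zero] at h
  exact h.symm

/-- If the ranks of the block matrices of `M` and `M'` agree on all families of sets of size at
most `k`, so do the dimensions of intersections. -/
theorem finrank_iInf_colSpan_congr {m k n : ℕ} {K K' : Type*} [Field K] [Field K'] (hm : 1 ≤ m)
    (M : Matrix (Fin k) (Fin n) K) (M' : Matrix (Fin k) (Fin n) K')
    (h : ∀ A : Fin (m + 1) → Finset (Fin n), (∀ i, (A i).card ≤ k) →
      Module.finrank K (Submodule.span K ((intersectionMatrix m M).col '' graphSet A)) =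
        Module.finrank K' (Submodule.span K' ((intersectionMatrix m M').col '' graphSet A)))
    (A : Fin (m + 1) → Finset (Fin n)) (hA : ∀ i, (A i).card ≤ k) :
    Module.finrank K (⨅ i, colSpan M (A i) : Submodule K (Fin k → K)) =
      Module.finrank K' (⨅ i, colSpan M' (A i) : Submodule K' (Fin k → K')) := by
  have h1 := finrank_iInf_colSpan_add M A
  have h2 := finrank_iInf_colSpan_add M' A
  have h3 : ∀ i, Module.finrank K (colSpan M (A i)) = Module.finrank K' (colSpan M' (A i)) := by
    intro i
    rw [finrank_colSpan_eq hm, finrank_colSpan_eq hm]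
    apply h
    intro j
    split_ifs
    · exact hA i
    · simp
  simp_rw [h3] at h1
  have := h A hA
  omega

/-! ### Counting small families -/

/-- For `i ≤ d` the weight `(n / d) ^ d * (d / n) ^ i` is at least 1; inserting it and extending the
sum to all `i ≤ n` gives a full binomial expansion, and `1 + x ≤ exp x` finishes. -/
theorem sum_choose_le_exp_pow {n d : ℕ} (hd : 1 ≤ d) (hdn : d ≤ n) :
    ∑ i ∈ Finset.range (d + 1), (n.choose i : ℝ) ≤ (Real.exp 1 * n / d) ^ d := by
  have hd0 : (0 : ℝ) < d := by exact_mod_cast hd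
  have hn0 : (0 : ℝ) < n := by exact_mod_cast hd.trans hdn
  have hx : 1 ≤ (n : ℝ) / d := by
    rw [le_div_iff₀ hd0, one_mul]
    exact_mod_cast hdn
  calc ∑ i ∈ Finset.range (d + 1), (n.choose i : ℝ)
      ≤ ∑ i ∈ Finset.range (d + 1),
          ((n : ℝ) / d) ^ d * (((d : ℝ) / n) ^ i * 1 ^ (n - i) * n.choose i) := by
        refine Finset.sum_le_sum fun i hi => ?_
        have hi' : i ≤ d := Nat.lt_succ_iff.1 (Finset.mem_range.1 hi)
        have h1 : 1 ≤ ((n : ℝ) / d) ^ d * ((d : ℝ) / n) ^ i := by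
          have : ((n : ℝ) / d) ^ d * ((d : ℝ) / n) ^ i = ((n : ℝ) / d) ^ (d - i) := by
            rw [← inv_div (n : ℝ) d, inv_pow, pow_sub₀ _ (by positivity) hi']
          rw [this]
          exact one_le_pow₀ hx
        rw [one_pow, mul_one, ← mul_assoc]
        exact le_mul_of_one_le_left (by positivity) h1
    _ ≤ ∑ i ∈ Finset.range (n + 1),
          ((n : ℝ) / d) ^ d * (((d : ℝ) / n) ^ i * 1 ^ (n - i) * n.choose i) := by
        refine Finset.sum_le_sum_of_subset_of_nonneg (fun i => ?_) fun i _ _ => by positivity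
        simp only [Finset.mem_range]
        omega
    _ = ((n : ℝ) / d) ^ d * ((d : ℝ) / n + 1) ^ n := by
        rw [← Finset.mul_sum, ← add_pow]
    _ ≤ ((n : ℝ) / d) ^ d * Real.exp ((d : ℝ) / n) ^ n := by
        gcongr
        exact Real.add_one_le_exp _
    _ = (Real.exp 1 * n / d) ^ d := by
        rw [← Real.exp_nat_mul, mul_div_cancel₀ _ hn0.ne', mul_div_assoc, mul_pow, mul_comm,
          ← Real.exp_nat_mul, mul_one]

theorem card_filter_card_le {n : ℕ} (d : ℕ) :
    ((Finset.univ : Finset (Finset (Fin n))).filter fun S => S.card ≤ d).card =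
      ∑ i ∈ Finset.range (d + 1), n.choose i := by
  rw [Finset.card_eq_sum_card_fiberwise (f := Finset.card) (t := Finset.range (d + 1))]
  · refine Finset.sum_congr rfl fun i hi => ?_
    rw [← Fintype.card_fin n, ← Finset.card_univ, ← Finset.card_powersetCard,
      Finset.card_fin]
    congr 1
    ext S
    simp only [Finset.mem_filter, Finset.mem_univ, true_and, Finset.mem_powersetCard,
      Finset.subset_univ, Finset.mem_range] at hi ⊢
    omega
  · intro S hS
    simp only [Finset.coe_filter, Finset.mem_univ, true_and, Set.mem_ofPred_eq, Finset.coe_range,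
      Set.mem_Iio] at hS ⊢
    omega

/-- Number of sets of size at most `Δ`. -/
theorem card_filter_card_le_min {n k ℓ Δ : ℕ} (hk : 1 ≤ k) (hkn : k ≤ n) (hℓ : 2 ≤ ℓ)
    (hΔ : Δ = (ℓ - 1) * k) :
    (((Finset.univ : Finset (Finset (Fin n))).filter fun S => S.card ≤ Δ).card : ℝ) ≤
      min ((2 : ℝ) ^ n) ((Δ : ℝ) * (Real.exp 1 * (n : ℝ) / ((Δ : ℝ) / (ℓ : ℝ))) ^ Δ) := by
  have hΔ1 : 1 ≤ Δ := by rw [hΔ]; exact Nat.one_le_iff_ne_zero.2 (by simp; omega)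
  have h2 : (((Finset.univ : Finset (Finset (Fin n))).filter fun S => S.card ≤ Δ).card : ℝ) ≤
      (2 : ℝ) ^ n := by
    have := Finset.card_le_univ
      ((Finset.univ : Finset (Finset (Fin n))).filter fun S => S.card ≤ Δ)
    rw [Fintype.card_finset, Fintype.card_fin] at this
    exact_mod_cast this
  have hΔ0 : (1 : ℝ) ≤ Δ := by exact_mod_cast hΔ1
  have hℓ1 : (1 : ℝ) ≤ ℓ := by exact_mod_cast (by omega : 1 ≤ ℓ)
  refine le_min h2 ?_
  refine le_trans ?_ (le_mul_of_one_le_left (by positivity) hΔ0)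
  rcases le_total Δ n with hle | hle
  · rw [card_filter_card_le]
    push_cast
    refine (sum_choose_le_exp_pow hΔ1 hle).trans ?_
    gcongr
    exact div_le_self (by positivity) hℓ1
  · refine h2.trans ?_
    -- As `Δ / ℓ ≤ k ≤ n`, the base is at least `e`, so its `Δ`-th power dominates `2 ^ Δ ≥ 2 ^ n`.
    have hb : 2 ≤ Real.exp 1 * (n : ℝ) / ((Δ : ℝ) / (ℓ : ℝ)) := by
      rw [le_div_iff₀ (by positivity)]
      have he : (2 : ℝ) ≤ Real.exp 1 := by linarith [Real.add_one_le_exp (1 : ℝ)]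
      have hn : (Δ : ℝ) / ℓ ≤ n := by
        rw [div_le_iff₀ (by positivity)]
        have : Δ ≤ n * ℓ := by
          rw [hΔ, mul_comm]
          exact Nat.mul_le_mul hkn (Nat.sub_le _ _)
        exact_mod_cast this
      exact mul_le_mul he hn (by positivity) (by positivity)
    calc (2 : ℝ) ^ n ≤ 2 ^ Δ := pow_le_pow_right₀ (by norm_num) hle
      _ ≤ _ := pow_le_pow_left₀ (by norm_num) hb _

/-- A nonempty subset of size at most `k` is the set of values of a `k`-tuple in `S`; the extra 1
accounts for the empty set. -/
theorem card_powerset_filter_card_le {n k : ℕ} (S : Finset (Fin n)) :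
    (S.powerset.filter fun B => B.card ≤ k).card ≤ S.card ^ k + 1 := by
  have hsub : (S.powerset.filter fun B => B.card ≤ k) ⊆
      insert ∅ ((Fintype.piFinset fun _ : Fin k => S).image fun f => Finset.univ.image f) := by
    intro B hB
    rw [Finset.mem_filter, Finset.mem_powerset] at hB
    rcases B.eq_empty_or_nonempty with rfl | ⟨x, hx⟩
    · exact Finset.mem_insert_self _ _
    · refine Finset.mem_insert_of_mem (Finset.mem_image.2 ?_)
      have hB0 : 0 < B.card := Finset.card_pos.2 ⟨x, hx⟩
      -- Enumerate `B`, then repeat `x`.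
      let f : Fin k → Fin n := fun i =>
        if h : (i : ℕ) < B.card then B.equivFin.symm ⟨i, h⟩ else x
      have hf : ∀ i, f i ∈ B := by
        intro i
        simp only [f]
        split_ifs
        · exact Subtype.coe_prop _
        · exact hx
      refine ⟨f, Fintype.mem_piFinset.2 fun i => hB.1 (hf i), ?_⟩
      ext y
      simp only [Finset.mem_image, Finset.mem_univ, true_and]
      constructor
      · rintro ⟨i, rfl⟩
        exact hf i
      · intro hy
        refine ⟨⟨B.equivFin ⟨y, hy⟩, (B.equivFin ⟨y, hy⟩).2.trans_le hB.2⟩, ?_⟩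
        simp [f]
  refine (Finset.card_le_card hsub).trans ((Finset.card_insert_le _ _).trans ?_)
  refine Nat.add_le_add_right (Finset.card_image_le.trans ?_) 1
  simp

/-- The families of `ℓ` sets of size at most `k` and total size at most `Δ`. -/
def smallFamilies (n k ℓ Δ : ℕ) : Finset (Fin ℓ → Finset (Fin n)) :=
  Finset.univ.filter fun A => (∀ i, (A i).card ≤ k) ∧ ∑ i, (A i).card ≤ Δ

/-- Count the possible unions `S`, of size at most `min Δ n`, then the choices of `ℓ` subsets of
`S`. -/
theorem card_smallFamilies_le {n k ℓ Δ : ℕ} (hk : 2 ≤ k) (hkn : k ≤ n) (hℓ : 2 ≤ ℓ)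
    (hΔ : Δ = (ℓ - 1) * k) :
    ((smallFamilies n k ℓ Δ).card : ℝ) ≤
      min ((2 : ℝ) ^ n) ((Δ : ℝ) * (Real.exp 1 * (n : ℝ) / ((Δ : ℝ) / (ℓ : ℝ))) ^ Δ) *
        min ((2 : ℝ) ^ (ℓ * min Δ n)) ((k : ℝ) ^ ℓ * ((min Δ n : ℕ) : ℝ) ^ (k * ℓ)) := by
  have hm : 1 ≤ min Δ n := by
    refine le_min ?_ (by omega)
    rw [hΔ]
    exact Nat.one_le_iff_ne_zero.2 (by simp; omega)
  have hsub : smallFamilies n k ℓ Δ ⊆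
      ((Finset.univ : Finset (Finset (Fin n))).filter fun S => S.card ≤ Δ).biUnion fun S =>
        Fintype.piFinset fun _ : Fin ℓ => S.powerset.filter fun B => B.card ≤ k := by
    intro A hA
    simp only [smallFamilies, Finset.mem_filter, Finset.mem_univ, true_and] at hA
    simp only [Finset.mem_biUnion, Finset.mem_filter, Finset.mem_univ, true_and,
      Fintype.mem_piFinset, Finset.mem_powerset]
    exact ⟨Finset.univ.biUnion A, Finset.card_biUnion_le.trans hA.2, fun i =>
      ⟨Finset.subset_biUnion_of_mem A (Finset.mem_univ i), hA.1 i⟩⟩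
  have hfib : ∀ S ∈ (Finset.univ : Finset (Finset (Fin n))).filter fun S => S.card ≤ Δ,
      (Fintype.piFinset fun _ : Fin ℓ => S.powerset.filter fun B => B.card ≤ k).card ≤
        min (2 ^ (ℓ * min Δ n)) (k ^ ℓ * (min Δ n) ^ (k * ℓ)) := by
    intro S hS
    have hS' : S.card ≤ min Δ n :=
      le_min (Finset.mem_filter.1 hS).2 ((Finset.card_le_univ S).trans (by simp))
    rw [Fintype.card_piFinset, Finset.prod_const, Finset.card_univ, Fintype.card_fin]
    refine le_min ?_ ?_
    · rw [mul_comm, pow_mul]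
      refine Nat.pow_le_pow_left ((Finset.card_filter_le _ _).trans ?_) _
      rw [Finset.card_powerset]
      exact Nat.pow_le_pow_right (by norm_num) hS'
    · rw [pow_mul, ← mul_pow]
      refine Nat.pow_le_pow_left ((card_powerset_filter_card_le S).trans ?_) _
      have h1 : S.card ^ k ≤ (min Δ n) ^ k := Nat.pow_le_pow_left hS' _
      have h2 : 1 ≤ (min Δ n) ^ k := Nat.one_le_pow _ _ hm
      -- Absorbing the extra 1 into the factor `k` is what requires `2 ≤ k`.
      calc S.card ^ k + 1 ≤ 2 * (min Δ n) ^ k := by omega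
        _ ≤ k * (min Δ n) ^ k := Nat.mul_le_mul_right _ hk
  have hcard := (Finset.card_le_card hsub).trans (Finset.card_biUnion_le_card_mul _ _ _ hfib)
  calc ((smallFamilies n k ℓ Δ).card : ℝ)
      ≤ (((Finset.univ : Finset (Finset (Fin n))).filter fun S => S.card ≤ Δ).card : ℝ) *
          ((min (2 ^ (ℓ * min Δ n)) (k ^ ℓ * (min Δ n) ^ (k * ℓ)) : ℕ) : ℝ) := by
        exact_mod_cast hcard
    _ ≤ _ := by
        refine mul_le_mul (card_filter_card_le_min (by omega) hkn hℓ hΔ) ?_ (by positivity)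
          (by positivity)
        push_cast
        exact le_rfl

theorem card_graphSet {ι α : Type*} [Fintype ι] (A : ι → Finset α) [Fintype (graphSet A)] :
    Fintype.card (graphSet A) = ∑ i, (A i).card := by
  let e : graphSet A ≃ Σ i, A i :=
    { toFun := fun x => ⟨x.1.1, x.1.2, x.2⟩
      invFun := fun x => ⟨(x.1, x.2.1), x.2.2⟩
      left_inv := fun _ => rfl
      right_inv := fun _ => rfl }
  rw [Fintype.card_congr e, Fintype.card_sigma]
  simp

/-! ### Specializing the generic matrix -/

/-- The matrix of indeterminates, over the polynomial ring. -/
noncomputable def variableMatrix (k n : ℕ) (F : Type*) [Field F] :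
    Matrix (Fin k) (Fin n) (MvPolynomial (Fin k × Fin n) F) :=
  fun i j => MvPolynomial.X (i, j)

theorem variableMatrix_map_algebraMap (k n : ℕ) (F : Type*) [Field F] :
    (variableMatrix k n F).map (algebraMap _ (FractionRing (MvPolynomial (Fin k × Fin n) F))) =
      genericMatrix k n F := rfl

theorem totalDegree_intersectionMatrix_le {k n m : ℕ} {F : Type*} [Field F] (a b) :
    (intersectionMatrix m (variableMatrix k n F) a b).totalDegree ≤ 1 := by
  unfold intersectionMatrix variableMatrix
  split_ifs
  · rw [MvPolynomial.totalDegree_X]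
  · simp

theorem finrank_span_col_eval_le {σ ι κ F : Type*} [Fintype ι] [Finite κ] [Field F]
    (N : Matrix ι κ (MvPolynomial σ F)) (g : σ → F) (E : Set κ) :
    Module.finrank F (Submodule.span F ((N.map (MvPolynomial.eval g)).col '' E)) ≤
      Module.finrank (FractionRing (MvPolynomial σ F)) (Submodule.span
        (FractionRing (MvPolynomial σ F))
        ((N.map (algebraMap _ (FractionRing (MvPolynomial σ F)))).col '' E)) :=
  finrank_span_image_le _ _ E fun b _ hb =>
    linearIndependent_col_map_algebraMap (N.submatrix id (Subtype.val : b → κ)) g hb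

theorem exists_finrank_span_intersectionMatrix_eq {k n m : ℕ} {F : Type*} [Field F] [Fintype F]
    (hq : (smallFamilies n k (m + 1) (m * k)).card * (m * k) < Fintype.card F) :
    ∃ G : Matrix (Fin k) (Fin n) F,
      ∀ A : Fin (m + 1) → Finset (Fin n), (∀ i, (A i).card ≤ k) →
        Module.finrank F (Submodule.span F ((intersectionMatrix m G).col '' graphSet A)) =
          Module.finrank (FractionRing (MvPolynomial (Fin k × Fin n) F))
            (Submodule.span (FractionRing (MvPolynomial (Fin k × Fin n) F))
              ((intersectionMatrix m (genericMatrix k n F)).col '' graphSet A)) := by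
  classical
  let N := intersectionMatrix m (variableMatrix k n F)
  choose p hp0 hpdeg hp using fun A : Fin (m + 1) → Finset (Fin n) =>
    exists_polynomial_linearIndependent_col
      (N.submatrix id (Subtype.val : graphSet A → Fin (m + 1) × Fin n))
      fun a b => totalDegree_intersectionMatrix_le a b.1
  obtain ⟨g, hg⟩ := exists_forall_eval_ne_zero (smallFamilies n k (m + 1) (m * k)) p (m * k)
    (fun A _ => hp0 A) (fun A hA => (hpdeg A).trans (by
      rw [card_graphSet]
      exact (Finset.mem_filter.1 hA).2.2)) hq
  refine ⟨(variableMatrix k n F).map (MvPolynomial.eval g), fun A hA => ?_⟩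
  rw [← variableMatrix_map_algebraMap, intersectionMatrix_map, intersectionMatrix_map]
  refine le_antisymm (finrank_span_col_eval_le N g _) ?_
  refine finrank_span_image_le _ _ _ fun b hb hli => ?_
  -- The independent column set `b`, read as a family of subsets of the `A i`.
  let B : Fin (m + 1) → Finset (Fin n) := fun i => Finset.univ.filter fun j => (i, j) ∈ b
  have hB : graphSet B = b := by
    ext x
    simp [graphSet, B]
  have hBA : ∀ i, (B i).card ≤ k := fun i =>
    (Finset.card_le_card fun j hj => hb (Finset.mem_filter.1 hj).2).trans (hA i)
  rw [← hB] at hli ⊢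
  -- Independent columns are no more numerous than the rows, so `B` is one of the families for which
  -- `g` was chosen.
  have hsum : ∑ i, (B i).card ≤ m * k := by
    rw [← card_graphSet]
    refine hli.fintype_card_le_finrank.trans ?_
    rw [Module.finrank_fintype_fun_eq_card, Fintype.card_prod, Fintype.card_fin, Fintype.card_fin]
  exact hp B hli g (hg B (Finset.mem_filter.2 ⟨Finset.mem_univ _, hBA, hsum⟩))

theorem isHigherOrderMDS_span_range {k n ℓ : ℕ} {F : Type*} [Field F]
    (G : Matrix (Fin k) (Fin n) F) (A₀ : Finset (Fin n))
    (hA₀ : k ≤ Module.finrank F (colSpan G A₀))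
    (hG : ∀ A : Fin ℓ → Finset (Fin n), (∀ i, (A i).card ≤ k) →
      Module.finrank F (⨅ i, colSpan G (A i) : Submodule F (Fin k → F)) =
        Module.finrank (FractionRing (MvPolynomial (Fin k × Fin n) F))
          (⨅ i, colSpan (genericMatrix k n F) (A i) :
            Submodule (FractionRing (MvPolynomial (Fin k × Fin n) F))
              (Fin k → FractionRing (MvPolynomial (Fin k × Fin n) F)))) :
    IsHigherOrderMDS k ℓ (Submodule.span F (Set.range fun i : Fin k => G i)) := by
  have hrank : G.rank = k := by
    refine le_antisymm (by simpa using G.rank_le_card_height) (hA₀.trans ?_)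
    rw [Matrix.rank_eq_finrank_span_cols]
    exact Submodule.finrank_mono (Submodule.span_mono (Set.image_subset_range _ _))
  have hrow : Module.finrank F (Submodule.span F (Set.range fun i : Fin k => G i)) = k := by
    exact (Matrix.rank_eq_finrank_span_row G).symm.trans hrank
  refine ⟨hrow, G, ⟨?_, rfl⟩, hG⟩
  rw [linearIndependent_iff_card_eq_finrank_span, Set.finrank, hrow, Fintype.card_fin]

/-- Specializing the first `k` columns to the identity already gives rank `k`. -/
theorem le_finrank_colSpan_genericMatrix {k n : ℕ} (hkn : k ≤ n) (F : Type*) [Field F] :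
    k ≤ Module.finrank (FractionRing (MvPolynomial (Fin k × Fin n) F))
      (colSpan (genericMatrix k n F) (Finset.univ.map (Fin.castLEEmb hkn))) := by
  let g : Fin k × Fin n → F := fun x => if (x.1 : ℕ) = x.2 then 1 else 0
  have htop : colSpan ((variableMatrix k n F).map (MvPolynomial.eval g))
      (Finset.univ.map (Fin.castLEEmb hkn)) = ⊤ := by
    rw [eq_top_iff, ← (Pi.basisFun F (Fin k)).span_eq, Submodule.span_le]
    rintro _ ⟨i, rfl⟩
    refine Submodule.subset_span ⟨Fin.castLEEmb hkn i, by simp, ?_⟩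
    ext j
    simp [variableMatrix, g, Pi.single_apply, Fin.ext_iff]
  have h := finrank_span_col_eval_le (variableMatrix k n F) g
    (Finset.univ.map (Fin.castLEEmb hkn) : Finset (Fin n))
  change Module.finrank F (colSpan ((variableMatrix k n F).map (MvPolynomial.eval g)) _) ≤ _ at h
  rw [htop, finrank_top, Module.finrank_fintype_fun_eq_card, Fintype.card_fin] at h
  exact h

theorem exists_isHigherOrderMDS {k n m : ℕ} (hkn : k ≤ n) (hm : 1 ≤ m) (F : Type*) [Field F]
    [Fintype F] (hq : (smallFamilies n k (m + 1) (m * k)).card * (m * k) < Fintype.card F) :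
    ∃ C : Submodule F (Fin n → F), IsHigherOrderMDS k (m + 1) C := by
  obtain ⟨G, hG⟩ := exists_finrank_span_intersectionMatrix_eq hq
  refine ⟨_, isHigherOrderMDS_span_range G (Finset.univ.map (Fin.castLEEmb hkn)) ?_
    (finrank_iInf_colSpan_congr hm _ _ hG)⟩
  -- `G` inherits full rank from the generic matrix, a single span being a case of the block rank.
  rw [finrank_colSpan_eq hm, hG _ fun i => by split_ifs <;> simp, ← finrank_colSpan_eq hm]
  exact le_finrank_colSpan_genericMatrix hkn F

/-! ### Dimension one and the conclusion -/

theorem colSpan_eq_top_of_forall_ne_zero {n : ℕ} {K : Type*} [Field K]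
    (M : Matrix (Fin 1) (Fin n) K) (hM : ∀ i j, M i j ≠ 0) {A : Finset (Fin n)}
    (hA : A.Nonempty) : colSpan M A = ⊤ := by
  obtain ⟨j, hj⟩ := hA
  rw [eq_top_iff]
  intro x _
  have h : x = (x 0 / M 0 j) • fun i => M i j := by
    ext i
    rw [Subsingleton.elim i 0]
    simp [hM]
  rw [h]
  exact Submodule.smul_mem _ _ (Submodule.subset_span ⟨j, hj, rfl⟩)

open Classical in
-- Every nonempty set of columns spans the whole line. The value does not depend on `M`, so the
-- all-ones row and the generic row agree.
theorem finrank_iInf_colSpan_of_forall_ne_zero {n ℓ : ℕ} {K : Type*} [Field K]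
    (M : Matrix (Fin 1) (Fin n) K) (hM : ∀ i j, M i j ≠ 0) (A : Fin ℓ → Finset (Fin n)) :
    Module.finrank K (⨅ i, colSpan M (A i) : Submodule K (Fin 1 → K)) =
      if ∃ i, A i = ∅ then 0 else 1 := by
  split_ifs with h
  · obtain ⟨i, hi⟩ := h
    have : ⨅ i, colSpan M (A i) = ⊥ :=
      eq_bot_iff.2 ((iInf_le _ i).trans (by rw [hi, colSpan_empty]))
    rw [this, finrank_bot]
  · have : ⨅ i, colSpan M (A i) = ⊤ := iInf_eq_top.2 fun i =>
      colSpan_eq_top_of_forall_ne_zero M hM (Finset.nonempty_iff_ne_empty.2 fun hi => h ⟨i, hi⟩)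
    rw [this, finrank_top]
    simp

/-- In dimension one the repetition code has the required property over every field. -/
theorem exists_isHigherOrderMDS_one {n : ℕ} (hn : 1 ≤ n) (ℓ : ℕ) (F : Type*) [Field F] :
    ∃ C : Submodule F (Fin n → F), IsHigherOrderMDS 1 ℓ C := by
  refine ⟨_, isHigherOrderMDS_span_range (fun _ _ => 1) {⟨0, hn⟩} ?_ fun A _ => ?_⟩
  · rw [colSpan_eq_top_of_forall_ne_zero _ (fun _ _ => one_ne_zero)
      (Finset.singleton_nonempty _), finrank_top]
    simp
  · rw [finrank_iInf_colSpan_of_forall_ne_zero _ fun _ _ => one_ne_zero,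
      finrank_iInf_colSpan_of_forall_ne_zero _ fun i j => ?_]
    rw [genericMatrix, Ne, map_eq_zero_iff _ (IsFractionRing.injective _ _)]
    exact MvPolynomial.X_ne_zero _

theorem mainTheorem2 (n k ℓ Δ q : ℕ) (hk : 1 ≤ k) (hkn : k ≤ n) (hℓ : 2 ≤ ℓ)
    (hΔ : Δ = (ℓ - 1) * k)
    (F : Type*) [Field F] [Fintype F] (hF : Fintype.card F = q)
    (hq : Real.exp 1 * (ℓ : ℝ) * (k : ℝ) ^ 2 *
        min ((2 : ℝ) ^ n)
          ((Δ : ℝ) * (Real.exp 1 * (n : ℝ) / ((Δ : ℝ) / (ℓ : ℝ))) ^ Δ) *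
        min ((2 : ℝ) ^ (ℓ * min Δ n))
          ((k : ℝ) ^ ℓ * ((min Δ n : ℕ) : ℝ) ^ (k * ℓ)) ≤ (q : ℝ)) :
    ∃ C : Submodule F (Fin n → F), IsHigherOrderMDS k ℓ C := by
  -- The count of families needs `2 ≤ k`.
  rcases hk.eq_or_lt with rfl | hk2
  · exact exists_isHigherOrderMDS_one hkn ℓ F
  obtain ⟨m, rfl⟩ : ∃ m, ℓ = m + 1 := ⟨ℓ - 1, by omega⟩
  rw [Nat.add_sub_cancel] at hΔ
  refine exists_isHigherOrderMDS hkn (by omega) F ?_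
  rw [hF, ← hΔ, ← Nat.cast_lt (α := ℝ), Nat.cast_mul]
  refine lt_of_lt_of_le ?_ hq
  have hcard := card_smallFamilies_le hk2 hkn hℓ hΔ
  have hΔpos : 0 < Δ := hΔ ▸ Nat.mul_pos (by omega) hk
  have hn : 0 < n := by omega
  have hpos : 0 < min ((2 : ℝ) ^ n)
      ((Δ : ℝ) * (Real.exp 1 * (n : ℝ) / ((Δ : ℝ) / ((m + 1 : ℕ) : ℝ))) ^ Δ) *
      min ((2 : ℝ) ^ ((m + 1) * min Δ n))
        ((k : ℝ) ^ (m + 1) * ((min Δ n : ℕ) : ℝ) ^ (k * (m + 1))) := by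
    have : 0 < min Δ n := lt_min hΔpos hn
    exact mul_pos (lt_min (by positivity) (by positivity)) (lt_min (by positivity) (by positivity))
  -- The prefactor in the bound on `q` only has to exceed the degree `Δ` of one minor.
  have hlt : (Δ : ℝ) < Real.exp 1 * ((m + 1 : ℕ) : ℝ) * (k : ℝ) ^ 2 := by
    have h1 : Δ < (m + 1) * k ^ 2 := by
      rw [hΔ]
      nlinarith
    have h2 : (Δ : ℝ) < ((m + 1 : ℕ) : ℝ) * (k : ℝ) ^ 2 := by exact_mod_cast h1
    rw [mul_assoc]
    exact h2.trans_le (le_mul_of_one_le_left (by positivity) (Real.one_le_exp zero_le_one))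
  rw [mul_assoc, mul_comm]
  exact (mul_le_mul_of_nonneg_left hcard (Nat.cast_nonneg _)).trans_lt
    (mul_lt_mul_of_pos_right hlt hpos)
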